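/- \textbf{Setup.} Let $Y_1,Y_0$ be real random variables (potential outcomes), $X\in\{0,1\}$ a treatment indicator, $W\in\mathbb R^d$ a covariate vector with support $\operatorname{supp}(W)$, and $Y=XY_1+(1-X)Y_0$ the realized outcome. Fix regular conditional distributions of $X$ given $W$, of $Y$ given $(X,W)$ and of $(Y_1,Y_0)$ given $(X,W)$; write $p_{x|w}=P(X=x\mid W=w)$ and $F_{Y\mid X,W}(y\mid x,w)=P(Y\le y\mid X=x,W=w)$. Let $\underline c,\overline c:\mathbb R^d\to\mathbb R$ be measurable bound functions. \emph{Overlap}: there is $\epsilon>0$ with $p_{1|w}\in[\epsilon,1-\epsilon]$ for all $w\in\operatorname{supp}(W)$. \emph{Joint $c$-dependence}: for all $w\in\operatorname{supp}(W)$, $0<\underline c(w)\le p_{1|w}\le\overline c(w)<1$ and $P(X=1\mid Y_1,Y_0,W=w)\in[\underline c(w),\overline c(w)]$ almost surely conditional on $W=w$. Omitting the argument $w$ of $\underline c,\overline c$, and with $F_x=F_{Y\mid X,W}(y\mid x,w)$, put \begin{align*} \underline F_{Y_1\mid W}(y\mid w)&=\max\Big\{F_1\tfrac{p_{1|w}}{\overline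 c},\ \tfrac{\underline c-p_{1|w}}{\underline c}+F_1\tfrac{p_{1|w}}{\underline c}\Big\}, & \overline F_{Y_1\mid W}(y\mid w)&=\min\Big\{F_1\tfrac{p_{1|w}}{\underline c},\ \tfrac{\overline c-p_{1|w}}{\overline c}+F_1\tfrac{p_{1|w}}{\overline c}\Big\},\\ \underline F_{Y_0\mid W}(y\mid w)&=\max\Big\{F_0\tfrac{p_{0|w}}{1-\underline c},\ \tfrac{p_{1|w}-\overline c}{1-\overline c}+F_0\tfrac{p_{0|w}}{1-\overline c}\Big\}, & \overline F_{Y_0\mid W}(y\mid w)&=\min\Big\{F_0\tfrac{p_{0|w}}{1-\overline c},\ \tfrac{p_{1|w}-\underline c}{1-\underline c}+F_0\tfrac{p_{0|w}}{1-\underline c}\Big\}. \end{align*} Let $\mathcal C_{1,0\mid X,W}$ be the set of all families $\{C_{x,w}\}_{x\in\{0,1\},\,w\in\operatorname{supp}(W)}$ of bivariate copulas. The identified set $\mathcal I^{\mathrm{joint}}$ consists of all triples $(\tilde F_1,\tilde F_0,C)$ with $C\in\mathcal C_{1,0\mid X,W}$ for which there is a conditional distribution (Markov kernel) $\tilde G$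 of $(Y_1,Y_0)$ given $(X,W)$ such that, for all $w\in\operatorname{supp}(W)$ and $x\in\{0,1\}$: $\tilde F_1(\cdot\mid x,w)$ and $\tilde F_0(\cdot\mid x,w)$ are the marginal cdfs of $Y_1$ and $Y_0$ under $\tilde G(\cdot\mid x,w)$, whose joint cdf is $C_{x,w}(\tilde F_1(y_1\mid x,w),\tilde F_0(y_0\mid x,w))$; $\tilde F_1(\cdot\mid 1,w)=F_{Y\mid X,W}(\cdot\mid 1,w)$ and $\tilde F_0(\cdot\mid 0,w)=F_{Y\mid X,W}(\cdot\mid 0,w)$; and joint $c$-dependence holds when $(Y_1,Y_0,X)$ given $W=w$ has the law determined by $p_{\cdot|w}$ and $\tilde G$. Let $\mathcal I_0^{\mathrm{joint}}$ be the image of $\mathcal I^{\mathrm{joint}}$ under replacing each $\tilde F_j$ by $(y,w)\mapsto\sum_{x\in\{0,1\}}\tilde F_j(y\mid x,w)\,p_{x|w}$, $w\in\operatorname{supp}(W)$. \textbf{Theorem.} Let overlap and joint $c$-dependence hold. Then for every $(\varepsilon,\gamma)\in[0,1]^2$ there exists $C_{1,0\mid X,W}\in\mathcal C_{1,0\mid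 X,W}$ such that $$\big(\varepsilon\underline F_{Y_1\mid W}+(1-\varepsilon)\overline F_{Y_1\mid W},\ \gamma\underline F_{Y_0\mid W}+(1-\gamma)\overline F_{Y_0\mid W},\ C_{1,0\mid X,W}\big)\in\mathcal I_0^{\mathrm{joint}}.$$ -/

import Mathlib

open MeasureTheory ProbabilityTheory Set

/-- The covariate space `ℝ^d`. -/
abbrev Covariate (d : ℕ) : Type := EuclideanSpace ℝ (Fin d)

/-- The realized outcome `Y = X Y₁ + (1 - X) Y₀`; the treatment value `1` is `true`. -/
def realizedOutcome {Ω : Type*} (X : Ω → Bool) (Y1 Y0 : Ω → ℝ) : Ω → ℝ :=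
  fun ω => if X ω then Y1 ω else Y0 ω

noncomputable section

variable {d : ℕ}

/-- `p_{x|w} = P(X = x | W = w)`, where `κX` is the conditional law of `X` given `W`. -/
def propensity (κX : Kernel (Covariate d) Bool) (x : Bool) (w : Covariate d) : ℝ :=
  (κX w).real {x}

/-- Strict overlap on the support `S` of the covariates. -/
def Overlap (S : Set (Covariate d)) (κX : Kernel (Covariate d) Bool) : Prop :=
  ∃ ε : ℝ, 0 < ε ∧ ∀ w ∈ S, propensity κX true w ∈ Icc ε (1 - ε)

/-- The law of `(X, (Y₁, Y₀))` given `W = w`, built from the conditional law `κX` of `X` given `W`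
and the conditional law `G` of `(Y₁, Y₀)` given `(W, X)`. -/
def latentLaw (κX : Kernel (Covariate d) Bool) (G : Kernel (Covariate d × Bool) (ℝ × ℝ))
    (w : Covariate d) : Measure (Bool × (ℝ × ℝ)) :=
  (κX ⊗ₖ G) w

/-- The latent propensity score `P(X = 1 | Y₁, Y₀, W = w)`: the conditional probability of
`X = 1` given the sigma-algebra generated by `(Y₁, Y₀)`, under the law given `W = w`. -/
def latentPropensity (κX : Kernel (Covariate d) Bool) (G : Kernel (Covariate d × Bool) (ℝ × ℝ))
    (w : Covariate d) : Bool × (ℝ × ℝ) → ℝ :=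
  (latentLaw κX G w)⟦{z : Bool × (ℝ × ℝ) | z.1 = true} |
    MeasurableSpace.comap (fun z : Bool × (ℝ × ℝ) => z.2) inferInstance⟧

/-- Joint `c`-dependence with bound functions `(cl, cu)`, for all covariate values in `S`. -/
def JointCDependence (S : Set (Covariate d)) (κX : Kernel (Covariate d) Bool)
    (G : Kernel (Covariate d × Bool) (ℝ × ℝ)) (cl cu : Covariate d → ℝ) : Prop :=
  ∀ w ∈ S,
    (0 < cl w ∧ cl w ≤ propensity κX true w ∧ propensity κX true w ≤ cu w ∧ cu w < 1) ∧
    ∀ᵐ z ∂(latentLaw κX G w), latentPropensity κX G w z ∈ Icc (cl w) (cu w)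

/-- Bivariate copulas. Only the values on `[0,1]²` are meaningful. -/
structure IsCopula (C : ℝ → ℝ → ℝ) : Prop where
  zero_left : ∀ v ∈ Icc (0 : ℝ) 1, C 0 v = 0
  zero_right : ∀ u ∈ Icc (0 : ℝ) 1, C u 0 = 0
  one_left : ∀ v ∈ Icc (0 : ℝ) 1, C 1 v = v
  one_right : ∀ u ∈ Icc (0 : ℝ) 1, C u 1 = u
  two_increasing : ∀ u ∈ Icc (0 : ℝ) 1, ∀ u' ∈ Icc (0 : ℝ) 1, ∀ v ∈ Icc (0 : ℝ) 1,
    ∀ v' ∈ Icc (0 : ℝ) 1, u ≤ u' → v ≤ v' → 0 ≤ C u' v' - C u' v - C u v' + C u v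

/-- Families of bivariate copulas indexed by `(x, w) ∈ {0,1} × S`. -/
def copulaFamilies (S : Set (Covariate d)) : Set (Bool → S → ℝ → ℝ → ℝ) :=
  {C | ∀ x w, IsCopula (C x w)}

/-- `F_{Y|X,W}(y | x, w)`, where `κY` is the conditional law of `Y` given `(W, X)`. -/
def outcomeCdf (κY : Kernel (Covariate d × Bool) ℝ) (x : Bool) (w : Covariate d) (y : ℝ) : ℝ :=
  cdf (κY (w, x)) y

/-- The lower bound on the cdf of `Y₁` given `W = w`. -/
def lowerCdf1 (κX : Kernel (Covariate d) Bool) (κY : Kernel (Covariate d × Bool) ℝ)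
    (cl cu : Covariate d → ℝ) (w : Covariate d) (y : ℝ) : ℝ :=
  max (outcomeCdf κY true w y * (propensity κX true w / cu w))
    ((cl w - propensity κX true w) / cl w
      + outcomeCdf κY true w y * (propensity κX true w / cl w))

/-- The upper bound on the cdf of `Y₁` given `W = w`. -/
def upperCdf1 (κX : Kernel (Covariate d) Bool) (κY : Kernel (Covariate d × Bool) ℝ)
    (cl cu : Covariate d → ℝ) (w : Covariate d) (y : ℝ) : ℝ :=
  min (outcomeCdf κY true w y * (propensity κX true w / cl w))
    ((cu w - propensity κX true w) / cu w
      + outcomeCdf κY true w y * (propensity κX true w / cu w))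

/-- The lower bound on the cdf of `Y₀` given `W = w`. -/
def lowerCdf0 (κX : Kernel (Covariate d) Bool) (κY : Kernel (Covariate d × Bool) ℝ)
    (cl cu : Covariate d → ℝ) (w : Covariate d) (y : ℝ) : ℝ :=
  max (outcomeCdf κY false w y * (propensity κX false w / (1 - cl w)))
    ((propensity κX true w - cu w) / (1 - cu w)
      + outcomeCdf κY false w y * (propensity κX false w / (1 - cu w)))

/-- The upper bound on the cdf of `Y₀` given `W = w`. -/
def upperCdf0 (κX : Kernel (Covariate d) Bool) (κY : Kernel (Covariate d × Bool) ℝ)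
    (cl cu : Covariate d → ℝ) (w : Covariate d) (y : ℝ) : ℝ :=
  min (outcomeCdf κY false w y * (propensity κX false w / (1 - cu w)))
    ((propensity κX true w - cl w) / (1 - cl w)
      + outcomeCdf κY false w y * (propensity κX false w / (1 - cl w)))

/-- The identified set for `(F_{Y₁|X,W}, F_{Y₀|X,W}, C_{1,0|X,W})` under joint `c`-dependence.
The observed distribution enters through the support `S` of `W`, the conditional law `κX` of `X`
given `W`, and the conditional law `κY` of `Y` given `(W, X)`. A triple belongs to the set if some
conditional law `G` of `(Y₁, Y₀)` given `(W, X)` has these margins and copulas, is compatible with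
the observed distribution, and satisfies joint `c`-dependence. -/
def identifiedSetJoint (S : Set (Covariate d)) (κX : Kernel (Covariate d) Bool)
    (κY : Kernel (Covariate d × Bool) ℝ) (cl cu : Covariate d → ℝ) :
    Set ((Bool → S → ℝ → ℝ) × (Bool → S → ℝ → ℝ) × (Bool → S → ℝ → ℝ → ℝ)) :=
  {T | T.2.2 ∈ copulaFamilies S ∧
    ∃ G : Kernel (Covariate d × Bool) (ℝ × ℝ), IsMarkovKernel G ∧
      (∀ (x : Bool) (w : S) (y : ℝ), T.1 x w y = (G (w, x)).real {z | z.1 ≤ y}) ∧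
      (∀ (x : Bool) (w : S) (y : ℝ), T.2.1 x w y = (G (w, x)).real {z | z.2 ≤ y}) ∧
      (∀ (x : Bool) (w : S) (y1 y0 : ℝ),
        (G (w, x)).real {z | z.1 ≤ y1 ∧ z.2 ≤ y0} = T.2.2 x w (T.1 x w y1) (T.2.1 x w y0)) ∧
      (∀ (w : S) (y : ℝ), T.1 true w y = outcomeCdf κY true w y) ∧
      (∀ (w : S) (y : ℝ), T.2.1 false w y = outcomeCdf κY false w y) ∧
      JointCDependence S κX G cl cu}

/-- Averaging a cdf given `(X, W)` over `X`, which gives the cdf given `W`. -/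
def averageOverTreatment {S : Set (Covariate d)} (κX : Kernel (Covariate d) Bool)
    (F : Bool → S → ℝ → ℝ) : S → ℝ → ℝ :=
  fun w y => F true w y * propensity κX true w + F false w y * propensity κX false w

/-- The identified set for `(F_{Y₁|W}, F_{Y₀|W}, C_{1,0|X,W})` under joint `c`-dependence. -/
def identifiedSetJoint0 (S : Set (Covariate d)) (κX : Kernel (Covariate d) Bool)
    (κY : Kernel (Covariate d × Bool) ℝ) (cl cu : Covariate d → ℝ) :
    Set ((S → ℝ → ℝ) × (S → ℝ → ℝ) × (Bool → S → ℝ → ℝ → ℝ)) :=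
  (fun T => (averageOverTreatment κX T.1, averageOverTreatment κX T.2.1, T.2.2)) ''
    identifiedSetJoint S κX κY cl cu

end

/-! Fix `w` and write `a`, `b`, `p` for `cl w`, `cu w`, `propensity κX true w`. Suppose `a < p < b`,
and introduce a latent type: high with probability `(p - a) / (b - a)`, low otherwise, with
treatment probability `b` for the high type and `a` for the low one. Given the type, let `X`, `Y₁`,
`Y₀` be independent. Then the propensity given `(Y₁, Y₀)` averages `a` and `b`, so joint
`c`-dependence holds whatever the laws within types.

Two linear conditions fix the type-specific cdfs of `Y₁`: their mixture given `X = 1` is the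
observed cdf `u`, and their unconditional mixture is the target `B = boundMix a b p ε u`. The
solutions are `(p u - a B) / (p - a)` for the high type and `(b B - p u) / (b - p)` for the low one.
Both are nondecreasing in `u` because the slopes of `B` lie between `p / b` and `p / a`
(`boundMix_sub_mem`). For `Y₀`, replace `(a, b, p)` by `(1 - b, 1 - a, 1 - p)`, which exchanges the
types. If `p = a` or `p = b`, the bounds collapse to the observed cdf (`boundMix_of_eq`), and a law
not depending on `X` suffices.

Given `(x, w)` the joint cdf is a mixture of two products of continuous distortions of the observed
cdfs. `exists_copula_of_mix` reads the copula off this formula, and `exists_latent_kernel` assembles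
everything measurably in `w`. -/

/-! ### Distortions, and copulas of mixed products. -/

/-- Continuous distortions of cdfs, taken as functions on the whole real line. -/
structure IsDistortion (Φ : ℝ → ℝ) : Prop where
  monotone : Monotone Φ
  continuous : Continuous Φ
  map_zero : Φ 0 = 0
  map_one : Φ 1 = 1

theorem IsDistortion.id : IsDistortion fun u => u :=
  ⟨monotone_id, continuous_id, rfl, rfl⟩

theorem IsDistortion.nonneg {Φ : ℝ → ℝ} (h : IsDistortion Φ) {u : ℝ} (hu : 0 ≤ u) : 0 ≤ Φ u := by
  simpa [h.map_zero] using h.monotone hu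

theorem IsDistortion.le_one {Φ : ℝ → ℝ} (h : IsDistortion Φ) {u : ℝ} (hu : u ≤ 1) : Φ u ≤ 1 := by
  simpa [h.map_one] using h.monotone hu

theorem IsDistortion.mix {Φ Ψ : ℝ → ℝ} (hΦ : IsDistortion Φ) (hΨ : IsDistortion Ψ) {m : ℝ}
    (hm : m ∈ Icc (0 : ℝ) 1) : IsDistortion fun u => m * Φ u + (1 - m) * Ψ u where
  monotone u v h := add_le_add (mul_le_mul_of_nonneg_left (hΦ.monotone h) hm.1)
    (mul_le_mul_of_nonneg_left (hΨ.monotone h) (sub_nonneg.2 hm.2))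
  continuous := by
    have := hΦ.continuous
    have := hΨ.continuous
    fun_prop
  map_zero := by simp [hΦ.map_zero, hΨ.map_zero]
  map_one := by simp [hΦ.map_one, hΨ.map_one]

theorem IsDistortion.exists_section {Φ : ℝ → ℝ} (h : IsDistortion Φ) :
    ∃ s : ℝ → ℝ, ∀ t ∈ Icc (0 : ℝ) 1, s t ∈ Icc (0 : ℝ) 1 ∧ Φ (s t) = t := by
  have key : ∀ t : ℝ, ∃ u : ℝ, t ∈ Icc (0 : ℝ) 1 → u ∈ Icc (0 : ℝ) 1 ∧ Φ u = t := by
    intro t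
    by_cases ht : t ∈ Icc (0 : ℝ) 1
    · have := intermediate_value_Icc (zero_le_one' ℝ) h.continuous.continuousOn
      rw [h.map_zero, h.map_one] at this
      obtain ⟨u, hu, hut⟩ := this ht
      exact ⟨u, fun _ => ⟨hu, hut⟩⟩
    · exact ⟨0, fun h => absurd h ht⟩
  choose s hs using key
  exact ⟨s, hs⟩

/-- Both terms move in the same direction between `u` and `v`, so neither can change if their sum
does not. The factor `m` cannot be cancelled, since it may be zero. This makes the copula
independent of the chosen section. -/
theorem IsDistortion.left_eq_of_mix_eq {Φ Ψ : ℝ → ℝ} (hΦ : IsDistortion Φ) (hΨ : IsDistortion Ψ)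
    {m : ℝ} (hm : m ∈ Icc (0 : ℝ) 1) {u v : ℝ}
    (h : m * Φ u + (1 - m) * Ψ u = m * Φ v + (1 - m) * Ψ v) : m * Φ u = m * Φ v := by
  rcases le_total u v with huv | huv
  all_goals
    have h1 := mul_le_mul_of_nonneg_left (hΦ.monotone huv) hm.1
    have h2 := mul_le_mul_of_nonneg_left (hΨ.monotone huv) (sub_nonneg.2 hm.2)
    linarith

theorem IsDistortion.left_mono_of_mix_le {Φ Ψ : ℝ → ℝ} (hΦ : IsDistortion Φ)
    (hΨ : IsDistortion Ψ) {m : ℝ} (hm : m ∈ Icc (0 : ℝ) 1) {u v : ℝ}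
    (h : m * Φ u + (1 - m) * Ψ u ≤ m * Φ v + (1 - m) * Ψ v) : m * Φ u ≤ m * Φ v := by
  rcases le_total u v with huv | huv
  · exact mul_le_mul_of_nonneg_left (hΦ.monotone huv) hm.1
  · exact (hΦ.left_eq_of_mix_eq hΨ hm (h.antisymm ((hΦ.mix hΨ hm).monotone huv))).le

/-- A mixture of two products of distorted margins is the image of its own margins under a
copula. -/
theorem exists_copula_of_mix {Φ Φ' Ψ Ψ' : ℝ → ℝ} (hΦ : IsDistortion Φ) (hΦ' : IsDistortion Φ')
    (hΨ : IsDistortion Ψ) (hΨ' : IsDistortion Ψ') {m : ℝ} (hm : m ∈ Icc (0 : ℝ) 1) :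
    ∃ C : ℝ → ℝ → ℝ, IsCopula C ∧ ∀ u ∈ Icc (0 : ℝ) 1, ∀ v ∈ Icc (0 : ℝ) 1,
      C (m * Φ u + (1 - m) * Φ' u) (m * Ψ v + (1 - m) * Ψ' v) =
        m * (Φ u * Ψ v) + (1 - m) * (Φ' u * Ψ' v) := by
  have hM := hΦ.mix hΦ' hm
  have hN := hΨ.mix hΨ' hm
  have hm' : 1 - m ∈ Icc (0 : ℝ) 1 := ⟨sub_nonneg.2 hm.2, by linarith [hm.1]⟩
  obtain ⟨s, hs⟩ := hM.exists_section
  obtain ⟨t, ht⟩ := hN.exists_section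
  have eqΦ {u v : ℝ} (h : m * Φ u + (1 - m) * Φ' u = m * Φ v + (1 - m) * Φ' v) :
      m * Φ u = m * Φ v ∧ (1 - m) * Φ' u = (1 - m) * Φ' v := by
    have := hΦ.left_eq_of_mix_eq hΦ' hm h
    exact ⟨this, by linarith⟩
  have eqΨ {u v : ℝ} (h : m * Ψ u + (1 - m) * Ψ' u = m * Ψ v + (1 - m) * Ψ' v) :
      m * Ψ u = m * Ψ v ∧ (1 - m) * Ψ' u = (1 - m) * Ψ' v := by
    have := hΨ.left_eq_of_mix_eq hΨ' hm h
    exact ⟨this, by linarith⟩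
  have leΦ {u v : ℝ} (h : m * Φ u + (1 - m) * Φ' u ≤ m * Φ v + (1 - m) * Φ' v) :
      m * Φ u ≤ m * Φ v ∧ (1 - m) * Φ' u ≤ (1 - m) * Φ' v :=
    ⟨hΦ.left_mono_of_mix_le hΦ' hm h, hΦ'.left_mono_of_mix_le hΦ hm' (by linarith)⟩
  have leΨ {u v : ℝ} (h : m * Ψ u + (1 - m) * Ψ' u ≤ m * Ψ v + (1 - m) * Ψ' v) :
      m * Ψ u ≤ m * Ψ v ∧ (1 - m) * Ψ' u ≤ (1 - m) * Ψ' v :=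
    ⟨hΨ.left_mono_of_mix_le hΨ' hm h, hΨ'.left_mono_of_mix_le hΨ hm' (by linarith)⟩
  have h0 : (0 : ℝ) ∈ Icc (0 : ℝ) 1 := ⟨le_rfl, zero_le_one⟩
  have h1 : (1 : ℝ) ∈ Icc (0 : ℝ) 1 := ⟨zero_le_one, le_rfl⟩
  -- The sections `s`, `t` invert the two margins, so this is the required formula pulled back to
  -- margin values.
  refine ⟨fun u v => m * (Φ (s u) * Ψ (t v)) + (1 - m) * (Φ' (s u) * Ψ' (t v)), ?_, ?_⟩
  · constructor
    · intro v hv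
      have := eqΦ ((hs 0 h0).2.trans hM.map_zero.symm)
      rw [hΦ.map_zero, hΦ'.map_zero] at this
      linear_combination Ψ (t v) * this.1 + Ψ' (t v) * this.2
    · intro u hu
      have := eqΨ ((ht 0 h0).2.trans hN.map_zero.symm)
      rw [hΨ.map_zero, hΨ'.map_zero] at this
      linear_combination Φ (s u) * this.1 + Φ' (s u) * this.2
    · intro v hv
      have := eqΦ ((hs 1 h1).2.trans hM.map_one.symm)
      rw [hΦ.map_one, hΦ'.map_one] at this
      linear_combination Ψ (t v) * this.1 + Ψ' (t v) * this.2 + (ht v hv).2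
    · intro u hu
      have := eqΨ ((ht 1 h1).2.trans hN.map_one.symm)
      rw [hΨ.map_one, hΨ'.map_one] at this
      linear_combination Φ (s u) * this.1 + Φ' (s u) * this.2 + (hs u hu).2
    · intro u hu u' hu' v hv v' hv' huv huv'
      have hA := leΦ (((hs u hu).2.trans_le huv).trans_eq (hs u' hu').2.symm)
      have hB := leΨ (((ht v hv).2.trans_le huv').trans_eq (ht v' hv').2.symm)
      -- Monotonicity along the sections is known only after multiplication by the weight; a zero
      -- weight kills its term.
      have prod_nonneg {k x y : ℝ} (hk : 0 ≤ k) (hx : 0 ≤ k * x) (hy : 0 ≤ k * y) :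
          0 ≤ k * (x * y) := by
        rcases hk.eq_or_lt with rfl | hk
        · simp
        · exact mul_nonneg hk.le
            (mul_nonneg (nonneg_of_mul_nonneg_right hx hk) (nonneg_of_mul_nonneg_right hy hk))
      have e1 : 0 ≤ m * ((Φ (s u') - Φ (s u)) * (Ψ (t v') - Ψ (t v))) :=
        prod_nonneg hm.1 (by linarith [hA.1]) (by linarith [hB.1])
      have e2 : 0 ≤ (1 - m) * ((Φ' (s u') - Φ' (s u)) * (Ψ' (t v') - Ψ' (t v))) :=
        prod_nonneg hm'.1 (by linarith [hA.2]) (by linarith [hB.2])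
      linear_combination e1 + e2
  · intro u hu v hv
    have hMu := eqΦ (hs _ ⟨hM.nonneg hu.1, hM.le_one hu.2⟩).2
    have hNv := eqΨ (ht _ ⟨hN.nonneg hv.1, hN.le_one hv.2⟩).2
    simp only at hMu hNv ⊢
    linear_combination Ψ (t (m * Ψ v + (1 - m) * Ψ' v)) * hMu.1 +
      Ψ' (t (m * Ψ v + (1 - m) * Ψ' v)) * hMu.2 + Φ u * hNv.1 + Φ' u * hNv.2

/-! ### The bounds as mixtures over two latent types. -/

/-- The convex combination of the lower and upper bounds on a potential outcome cdf, as a function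
of the observed conditional cdf. -/
noncomputable def boundMix (a b p ε u : ℝ) : ℝ :=
  ε * max (u * (p / b)) ((a - p) / a + u * (p / a)) +
    (1 - ε) * min (u * (p / a)) ((b - p) / b + u * (p / b))

/-- The conditional distortion for the latent type with the high propensity `b`. -/
noncomputable def highDistortion (a b p ε u : ℝ) : ℝ := (p * u - a * boundMix a b p ε u) / (p - a)

/-- The conditional distortion for the latent type with the low propensity `a`. -/
noncomputable def lowDistortion (a b p ε u : ℝ) : ℝ := (b * boundMix a b p ε u - p * u) / (b - p)

section

variable {a b p ε : ℝ}

theorem boundMix_zero (ha : 0 < a) (hap : a ≤ p) (hpb : p ≤ b) : boundMix a b p ε 0 = 0 := by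
  have h1 : (a - p) / a ≤ 0 := div_nonpos_of_nonpos_of_nonneg (by linarith) ha.le
  have h2 : 0 ≤ (b - p) / b := div_nonneg (by linarith) (by linarith)
  simp [boundMix, h1, h2]

theorem boundMix_one (ha : 0 < a) (hap : a ≤ p) (hpb : p ≤ b) : boundMix a b p ε 1 = 1 := by
  have hb : 0 < b := by linarith
  have h1 : (a - p) / a + p / a = 1 := by field_simp; ring
  have h2 : (b - p) / b + p / b = 1 := by field_simp; ring
  have h3 : p / b ≤ 1 := (div_le_one hb).2 hpb
  have h4 : 1 ≤ p / a := (one_le_div ha).2 hap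
  simp [boundMix, h1, h2, h3, h4]

theorem continuous_boundMix : Continuous (boundMix a b p ε) := by
  unfold boundMix
  fun_prop

/-- Each affine piece has slope `p / b` or `p / a`, and bounds on increments survive maxima, minima
and convex combinations. The upper bound makes `highDistortion` nondecreasing, the lower one
`lowDistortion`. -/
theorem boundMix_sub_mem (ha : 0 < a) (hap : a ≤ p) (hpb : p ≤ b) (hε : ε ∈ Icc (0 : ℝ) 1)
    {u v : ℝ} (huv : u ≤ v) :
    boundMix a b p ε v - boundMix a b p ε u ∈ Icc (p / b * (v - u)) (p / a * (v - u)) := by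
  have hk : p / b ≤ p / a := div_le_div_of_nonneg_left (by linarith) ha (by linarith)
  have hk' : p / b * (v - u) ≤ p / a * (v - u) := mul_le_mul_of_nonneg_right hk (by linarith)
  have hmax : max (v * (p / b)) ((a - p) / a + v * (p / a)) -
      max (u * (p / b)) ((a - p) / a + u * (p / a)) ∈
        Icc (p / b * (v - u)) (p / a * (v - u)) := by
    constructor
    · have : max (u * (p / b)) ((a - p) / a + u * (p / a)) ≤
          max (v * (p / b)) ((a - p) / a + v * (p / a)) - p / b * (v - u) :=
        max_le (by linarith [le_max_left (v * (p / b)) ((a - p) / a + v * (p / a))])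
          (by linarith [le_max_right (v * (p / b)) ((a - p) / a + v * (p / a))])
      linarith
    · have : max (v * (p / b)) ((a - p) / a + v * (p / a)) ≤
          max (u * (p / b)) ((a - p) / a + u * (p / a)) + p / a * (v - u) :=
        max_le (by linarith [le_max_left (u * (p / b)) ((a - p) / a + u * (p / a))])
          (by linarith [le_max_right (u * (p / b)) ((a - p) / a + u * (p / a))])
      linarith
  have hmin : min (v * (p / a)) ((b - p) / b + v * (p / b)) -
      min (u * (p / a)) ((b - p) / b + u * (p / b)) ∈
        Icc (p / b * (v - u)) (p / a * (v - u)) := by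
    constructor
    · have : min (u * (p / a)) ((b - p) / b + u * (p / b)) + p / b * (v - u) ≤
          min (v * (p / a)) ((b - p) / b + v * (p / b)) :=
        le_min (by linarith [min_le_left (u * (p / a)) ((b - p) / b + u * (p / b))])
          (by linarith [min_le_right (u * (p / a)) ((b - p) / b + u * (p / b))])
      linarith
    · have : min (v * (p / a)) ((b - p) / b + v * (p / b)) - p / a * (v - u) ≤
          min (u * (p / a)) ((b - p) / b + u * (p / b)) :=
        le_min (by linarith [min_le_left (v * (p / a)) ((b - p) / b + v * (p / b))])
          (by linarith [min_le_right (v * (p / a)) ((b - p) / b + v * (p / b))])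
      linarith
  have h1 := mul_le_mul_of_nonneg_left hmax.1 hε.1
  have h2 := mul_le_mul_of_nonneg_left hmax.2 hε.1
  have h3 := mul_le_mul_of_nonneg_left hmin.1 (sub_nonneg.2 hε.2)
  have h4 := mul_le_mul_of_nonneg_left hmin.2 (sub_nonneg.2 hε.2)
  unfold boundMix
  constructor <;> linarith

theorem isDistortion_highDistortion (ha : 0 < a) (hap : a < p) (hpb : p < b)
    (hε : ε ∈ Icc (0 : ℝ) 1) : IsDistortion (highDistortion a b p ε) where
  monotone u v huv := by
    have h := mul_le_mul_of_nonneg_left (boundMix_sub_mem ha hap.le hpb.le hε huv).2 ha.le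
    have e : a * (p / a * (v - u)) = p * (v - u) := by field_simp
    exact div_le_div_of_nonneg_right (by linarith) (by linarith)
  continuous := by
    have := continuous_boundMix (a := a) (b := b) (p := p) (ε := ε)
    unfold highDistortion
    fun_prop
  map_zero := by simp [highDistortion, boundMix_zero ha hap.le hpb.le]
  map_one := by
    simp [highDistortion, boundMix_one ha hap.le hpb.le, div_self (sub_pos.2 hap).ne']

theorem isDistortion_lowDistortion (ha : 0 < a) (hap : a < p) (hpb : p < b)
    (hε : ε ∈ Icc (0 : ℝ) 1) : IsDistortion (lowDistortion a b p ε) where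
  monotone u v huv := by
    have hb : 0 < b := by linarith
    have h := mul_le_mul_of_nonneg_left (boundMix_sub_mem ha hap.le hpb.le hε huv).1 hb.le
    have e : b * (p / b * (v - u)) = p * (v - u) := by field_simp
    exact div_le_div_of_nonneg_right (by linarith) (by linarith)
  continuous := by
    have := continuous_boundMix (a := a) (b := b) (p := p) (ε := ε)
    unfold lowDistortion
    fun_prop
  map_zero := by simp [lowDistortion, boundMix_zero ha hap.le hpb.le]
  map_one := by
    simp [lowDistortion, boundMix_one ha hap.le hpb.le, div_self (sub_pos.2 hpb).ne']

/-- The probability of the latent type with the high propensity `b`, given `X = 1`. -/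
noncomputable def highWeight (a b p : ℝ) : ℝ := (p - a) / (b - a) * b / p

theorem highWeight_mem (ha : 0 < a) (hap : a < p) (hpb : p < b) :
    highWeight a b p ∈ Icc (0 : ℝ) 1 := by
  have hp : 0 < p := by linarith
  have hb : 0 < b := by linarith
  have hba : 0 < b - a := by linarith
  have hpa : 0 < p - a := by linarith
  unfold highWeight
  refine ⟨by positivity, ?_⟩
  rw [div_le_one hp, div_mul_eq_mul_div, div_le_iff₀ hba]
  nlinarith

/-- The target cancels, since the Bayes weights given `X = 1` are proportional to `(p - a) * b` and
`(b - p) * a`; this is compatibility with the observed arm. -/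
theorem highWeight_mix (ha : 0 < a) (hap : a < p) (hpb : p < b) (u : ℝ) :
    highWeight a b p * highDistortion a b p ε u +
      (1 - highWeight a b p) * lowDistortion a b p ε u = u := by
  have hp : p ≠ 0 := by linarith
  have hba : b - a ≠ 0 := by linarith
  have hpa : p - a ≠ 0 := by linarith
  have hbp : b - p ≠ 0 := by linarith
  unfold highWeight highDistortion lowDistortion
  field_simp
  ring

theorem boundMix_eq_mix (hap : a < p) (hpb : p < b) (u : ℝ) :
    boundMix a b p ε u = (p - a) / (b - a) * highDistortion a b p ε u +
      (b - p) / (b - a) * lowDistortion a b p ε u := by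
  have hba : b - a ≠ 0 := by linarith
  have hpa : p - a ≠ 0 := by linarith
  have hbp : b - p ≠ 0 := by linarith
  unfold highDistortion lowDistortion
  field_simp
  ring

/-- The bounds collapse to the observed conditional cdf when a propensity bound is attained. -/
theorem boundMix_of_eq (ha : 0 < a) (hap : a ≤ p) (hpb : p ≤ b) (h : p = a ∨ p = b) {u : ℝ}
    (hu : u ∈ Icc (0 : ℝ) 1) : boundMix a b p ε u = u := by
  have hp : 0 < p := by linarith
  have hb : 0 < b := by linarith
  rcases h with rfl | rfl
  · have h1 : p / b ≤ 1 := (div_le_one hb).2 hpb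
    have h2 : u * (p / b) ≤ u := mul_le_of_le_one_right hu.1 h1
    have h3 : u ≤ (b - p) / b + u * (p / b) := by
      have : (b - p) / b = 1 - p / b := by field_simp
      nlinarith [hu.2]
    simp only [boundMix, sub_self, zero_div, zero_add, div_self hp.ne', mul_one, max_eq_right h2,
      min_eq_left h3]
    ring
  · have h1 : 1 ≤ p / a := (one_le_div ha).2 hap
    have h2 : u ≤ u * (p / a) := le_mul_of_one_le_right hu.1 h1
    have h3 : (a - p) / a + u * (p / a) ≤ u := by
      have : (a - p) / a = 1 - p / a := by field_simp
      nlinarith [hu.2]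
    simp only [boundMix, sub_self, zero_div, zero_add, div_self hp.ne', mul_one, max_eq_left h3,
      min_eq_right h2]
    ring

end

/-! ### Kernels from distortions and mixtures. -/

/-- Continuity of the distortion preserves right-continuity and the limits at infinity;
measurability of the kernel need only be checked on the half-lines `Iic y`. -/
theorem exists_kernel_of_distortion {E : Type*} [MeasurableSpace E] (κ : Kernel E ℝ)
    {Φ : E → ℝ → ℝ} (hΦ : ∀ e, IsDistortion (Φ e))
    (hmeas : ∀ y, Measurable fun e => Φ e (cdf (κ e) y)) :
    ∃ K : Kernel E ℝ, IsMarkovKernel K ∧ ∀ e y, cdf (K e) y = Φ e (cdf (κ e) y) := by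
  let f : E → StieltjesFunction ℝ := fun e =>
    { toFun := fun y => Φ e (cdf (κ e) y)
      mono' := (hΦ e).monotone.comp (monotone_cdf _)
      right_continuous' := fun y =>
        (hΦ e).continuous.continuousAt.comp_continuousWithinAt ((cdf (κ e)).right_continuous y) }
  have hbot e : Filter.Tendsto (f e) Filter.atBot (nhds 0) := by
    have := ((hΦ e).continuous.tendsto 0).comp (tendsto_cdf_atBot (κ e))
    rwa [(hΦ e).map_zero] at this
  have htop e : Filter.Tendsto (f e) Filter.atTop (nhds 1) := by
    have := ((hΦ e).continuous.tendsto 1).comp (tendsto_cdf_atTop (κ e))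
    rwa [(hΦ e).map_one] at this
  have hprob e : IsProbabilityMeasure (f e).measure :=
    (f e).isProbabilityMeasure (hbot e) (htop e)
  refine ⟨⟨fun e => (f e).measure, ?_⟩, ⟨hprob⟩, fun e y => ?_⟩
  · refine Measurable.measure_of_isPiSystem_of_isProbabilityMeasure
      ((BorelSpace.measurable_eq (α := ℝ)).trans (borel_eq_generateFrom_Iic ℝ)) isPiSystem_Iic ?_
    rintro _ ⟨y, rfl⟩
    simp only [StieltjesFunction.measure_Iic _ (hbot _), sub_zero]
    exact (hmeas y).ennreal_ofReal
  · change cdf (f e).measure y = f e y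
    rw [cdf_measure_stieltjesFunction _ (hbot e) (htop e)]

theorem exists_kernel_mix {E Z : Type*} [MeasurableSpace E] [MeasurableSpace Z]
    (K K' : Kernel E Z) [IsMarkovKernel K] [IsMarkovKernel K'] {m : E → ℝ} (hm : Measurable m)
    (hm01 : ∀ e, m e ∈ Icc (0 : ℝ) 1) :
    ∃ G : Kernel E Z, IsMarkovKernel G ∧
      ∀ e s, (G e).real s = m e * (K e).real s + (1 - m e) * (K' e).real s := by
  let G : Kernel E Z :=
    ⟨fun e => ENNReal.ofReal (m e) • K e + ENNReal.ofReal (1 - m e) • K' e, by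
      refine Measure.measurable_of_measurable_coe _ fun s hs => ?_
      simp only [Measure.coe_add, Measure.coe_smul, Pi.add_apply, Pi.smul_apply, smul_eq_mul]
      exact (hm.ennreal_ofReal.mul (K.measurable_coe hs)).add
        ((measurable_const.sub hm).ennreal_ofReal.mul (K'.measurable_coe hs))⟩
  have hG e : G e = ENNReal.ofReal (m e) • K e + ENNReal.ofReal (1 - m e) • K' e := rfl
  refine ⟨G, ⟨fun e => ⟨?_⟩⟩, fun e s => ?_⟩
  · simp only [hG, Measure.coe_add, Measure.coe_smul, Pi.add_apply, Pi.smul_apply, measure_univ,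
      smul_eq_mul, mul_one]
    rw [← ENNReal.ofReal_add (hm01 e).1 (sub_nonneg.2 (hm01 e).2)]
    simp
  · have h1 : ENNReal.ofReal (m e) * K e s ≠ ⊤ :=
      ENNReal.mul_ne_top ENNReal.ofReal_ne_top (measure_ne_top _ _)
    have h2 : ENNReal.ofReal (1 - m e) * K' e s ≠ ⊤ :=
      ENNReal.mul_ne_top ENNReal.ofReal_ne_top (measure_ne_top _ _)
    simp only [Measure.real, hG, Measure.coe_add, Measure.coe_smul, Pi.add_apply, Pi.smul_apply,
      smul_eq_mul]
    rw [ENNReal.toReal_add h1 h2, ENNReal.toReal_mul, ENNReal.toReal_mul,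
      ENNReal.toReal_ofReal (hm01 e).1, ENNReal.toReal_ofReal (sub_nonneg.2 (hm01 e).2)]

/-! ### Bounds on the latent propensity from averages over events. -/

/-- A conditional probability lies between two constants as soon as it does so on average over
every event of the conditioning sigma-algebra. -/
theorem ae_condExp_indicator_mem_Icc {Z : Type*} {m m0 : MeasurableSpace Z} (hm : m ≤ m0)
    (μ : Measure Z) [IsFiniteMeasure μ] {A : Set Z} (hA : MeasurableSet A) {a b : ℝ}
    (h : ∀ t, MeasurableSet[m] t → μ.real (A ∩ t) ∈ Icc (a * μ.real t) (b * μ.real t)) :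
    ∀ᵐ z ∂μ, (μ⟦A | m⟧) z ∈ Icc a b := by
  have hint : Integrable (A.indicator fun _ => (1 : ℝ)) μ := (integrable_const 1).indicator hA
  have hset : ∀ t, MeasurableSet[m] t →
      ∫ z in t, (μ⟦A | m⟧) z ∂(μ.trim hm) = μ.real (A ∩ t) := by
    intro t ht
    rw [← setIntegral_trim hm stronglyMeasurable_condExp ht, setIntegral_condExp hm hint ht,
      setIntegral_indicator hA, setIntegral_const, smul_eq_mul, mul_one, inter_comm]
  have hconst : ∀ (c : ℝ) (t : Set Z), MeasurableSet[m] t →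
      ∫ _ in t, c ∂(μ.trim hm) = c * μ.real t := by
    intro c t ht
    rw [setIntegral_const, smul_eq_mul, mul_comm, Measure.real, trim_measurableSet_eq hm ht,
      Measure.real]
  have hcond : Integrable (μ⟦A | m⟧) (μ.trim hm) :=
    integrable_condExp.trim hm stronglyMeasurable_condExp
  -- The comparison is made under the trimmed measure, because the integral inequalities are
  -- available only for sets of the smaller sigma-algebra.
  have hl : (fun _ => a) ≤ᵐ[μ] μ⟦A | m⟧ := by
    refine ae_le_of_ae_le_trim (hm := hm)
      (ae_le_of_forall_setIntegral_le (integrable_const a) hcond fun t ht _ => ?_)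
    rw [hset t ht, hconst a t ht]
    exact (h t ht).1
  have hu : μ⟦A | m⟧ ≤ᵐ[μ] fun _ => b := by
    refine ae_le_of_ae_le_trim (hm := hm)
      (ae_le_of_forall_setIntegral_le hcond (integrable_const b) fun t ht _ => ?_)
    rw [hset t ht, hconst b t ht]
    exact (h t ht).2
  filter_upwards [hl, hu] with z h1 h2 using ⟨h1, h2⟩

section

variable {d : ℕ}

theorem latentLaw_real (κX : Kernel (Covariate d) Bool) [IsMarkovKernel κX]
    (G : Kernel (Covariate d × Bool) (ℝ × ℝ)) [IsMarkovKernel G] (w : Covariate d)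
    {s : Set (Bool × (ℝ × ℝ))} (hs : MeasurableSet s) :
    (latentLaw κX G w).real s =
      propensity κX true w * (G (w, true)).real (Prod.mk true ⁻¹' s) +
        propensity κX false w * (G (w, false)).real (Prod.mk false ⁻¹' s) := by
  rw [latentLaw, Measure.real, Kernel.compProd_apply hs, lintegral_fintype, Fintype.sum_bool,
    ENNReal.toReal_add (by finiteness) (by finiteness), ENNReal.toReal_mul, ENNReal.toReal_mul]
  simp only [propensity, Measure.real]
  ring

theorem ae_latentPropensity_mem_Icc (κX : Kernel (Covariate d) Bool) [IsMarkovKernel κX]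
    (G : Kernel (Covariate d × Bool) (ℝ × ℝ)) [IsMarkovKernel G] (w : Covariate d) {a b : ℝ}
    (h : ∀ s : Set (ℝ × ℝ),
      propensity κX true w * (G (w, true)).real s ∈
        Icc (a * (propensity κX true w * (G (w, true)).real s +
            propensity κX false w * (G (w, false)).real s))
          (b * (propensity κX true w * (G (w, true)).real s +
            propensity κX false w * (G (w, false)).real s))) :
    ∀ᵐ z ∂(latentLaw κX G w), latentPropensity κX G w z ∈ Icc a b := by
  have hA : MeasurableSet {z : Bool × (ℝ × ℝ) | z.1 = true} :=
    measurable_fst (measurableSet_singleton true)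
  have : IsFiniteMeasure (latentLaw κX G w) := by unfold latentLaw; infer_instance
  refine ae_condExp_indicator_mem_Icc measurable_snd.comap_le _ hA ?_
  rintro _ ⟨s, hs, rfl⟩
  have hs' : MeasurableSet ((fun z : Bool × (ℝ × ℝ) => z.2) ⁻¹' s) := measurable_snd hs
  rw [latentLaw_real κX G w hs', latentLaw_real κX G w (hA.inter hs')]
  simpa [← preimage_comp, Function.comp_def] using h s

theorem propensity_false (κX : Kernel (Covariate d) Bool) [IsMarkovKernel κX] (w : Covariate d) :
    propensity κX false w = 1 - propensity κX true w := by
  have h : ({true} : Set Bool)ᶜ = {false} := by ext x; cases x <;> simp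
  rw [propensity, propensity, ← h, probReal_compl_eq_one_sub (measurableSet_singleton true)]

theorem measurable_propensity (κX : Kernel (Covariate d) Bool) (x : Bool) :
    Measurable (propensity κX x) :=
  (κX.measurable_coe (measurableSet_singleton x)).ennreal_toReal

theorem measurable_outcomeCdf (κY : Kernel (Covariate d × Bool) ℝ) [IsMarkovKernel κY] (x : Bool)
    (y : ℝ) : Measurable fun w => outcomeCdf κY x w y := by
  simp only [outcomeCdf, cdf_eq_real]
  exact ((κY.measurable_coe measurableSet_Iic).comp measurable_prodMk_right).ennreal_toReal

theorem outcomeCdf_mem (κY : Kernel (Covariate d × Bool) ℝ) (x : Bool)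
    (w : Covariate d) (y : ℝ) : outcomeCdf κY x w y ∈ Icc (0 : ℝ) 1 :=
  ⟨cdf_nonneg _ _, cdf_le_one _ _⟩

end

/-! ### Type weights in the two treatment arms. -/

section

variable {a b p ε : ℝ}

theorem mul_highWeight (hp : 0 < p) :
    p * highWeight a b p = (p - a) / (b - a) * b := by
  unfold highWeight
  field_simp

theorem mul_one_sub_highWeight (hp : 0 < p) (hba : a < b) :
    p * (1 - highWeight a b p) = (b - p) / (b - a) * a := by
  have hba' : b - a ≠ 0 := by linarith
  rw [mul_sub, mul_highWeight hp]
  field_simp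
  ring

/-- After complementing the propensities, the "high" type is the original low one: both sides are
the joint probability of that type and `X = 0`. -/
theorem mul_highWeight_compl (hp : p < 1) :
    (1 - p) * highWeight (1 - b) (1 - a) (1 - p) = (b - p) / (b - a) * (1 - a) := by
  rw [mul_highWeight (sub_pos.2 hp)]
  congr 2 <;> ring

theorem mul_one_sub_highWeight_compl (hp : p < 1) (hba : a < b) :
    (1 - p) * (1 - highWeight (1 - b) (1 - a) (1 - p)) = (p - a) / (b - a) * (1 - b) := by
  rw [mul_one_sub_highWeight (sub_pos.2 hp) (by linarith)]
  congr 2 <;> ring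

/-- Split `p * u` by type as well: adding the joint probabilities of type and treatment over both
arms restores the unconditional type probabilities of `boundMix_eq_mix`. -/
theorem average_eq_boundMix (hap : a < p) (hpb : p < b) (hp0 : 0 < p) (hp1 : p < 1) (u : ℝ) :
    p * u + (1 - p) * ((1 - highWeight (1 - b) (1 - a) (1 - p)) * highDistortion a b p ε u +
      highWeight (1 - b) (1 - a) (1 - p) * lowDistortion a b p ε u) = boundMix a b p ε u := by
  have hu : p * u = p * highWeight a b p * highDistortion a b p ε u +
      p * (1 - highWeight a b p) * lowDistortion a b p ε u := by
    have hba : b - a ≠ 0 := by linarith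
    have hpa : p - a ≠ 0 := by linarith
    have hbp : b - p ≠ 0 := by linarith
    rw [mul_highWeight hp0, mul_one_sub_highWeight hp0 (hap.trans hpb)]
    unfold highDistortion lowDistortion
    field_simp
    ring
  rw [boundMix_eq_mix hap hpb, hu, mul_highWeight hp0, mul_one_sub_highWeight hp0 (hap.trans hpb)]
  linear_combination
    highDistortion a b p ε u * mul_one_sub_highWeight_compl hp1 (hap.trans hpb) +
      lowDistortion a b p ε u * mul_highWeight_compl (a := a) (b := b) hp1

end

@[fun_prop]
theorem measurable_highDistortion {E : Type*} [MeasurableSpace E] {a b p u : E → ℝ} {ε : ℝ}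
    (ha : Measurable a) (hb : Measurable b) (hp : Measurable p) (hu : Measurable u) :
    Measurable fun e => highDistortion (a e) (b e) (p e) ε (u e) := by
  unfold highDistortion boundMix
  fun_prop

@[fun_prop]
theorem measurable_lowDistortion {E : Type*} [MeasurableSpace E] {a b p u : E → ℝ} {ε : ℝ}
    (ha : Measurable a) (hb : Measurable b) (hp : Measurable p) (hu : Measurable u) :
    Measurable fun e => lowDistortion (a e) (b e) (p e) ε (u e) := by
  unfold lowDistortion boundMix
  fun_prop

@[fun_prop]
theorem measurable_highWeight {E : Type*} [MeasurableSpace E] {a b p : E → ℝ}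
    (ha : Measurable a) (hb : Measurable b) (hp : Measurable p) :
    Measurable fun e => highWeight (a e) (b e) (p e) := by
  unfold highWeight
  fun_prop

/-! ### The two-type law and its propensity. -/

/-- Two mixtures, with weights `m x`, of product kernels whose margins are distortions of two given
kernels. -/
theorem exists_kernel_mix_prod {E : Type*} [MeasurableSpace E] (κ1 κ0 : Kernel E ℝ)
    {Φ Φ' Ψ Ψ' : E → ℝ → ℝ} (hΦ : ∀ e, IsDistortion (Φ e)) (hΦ' : ∀ e, IsDistortion (Φ' e))
    (hΨ : ∀ e, IsDistortion (Ψ e)) (hΨ' : ∀ e, IsDistortion (Ψ' e))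
    (mΦ : ∀ y, Measurable fun e => Φ e (cdf (κ1 e) y))
    (mΦ' : ∀ y, Measurable fun e => Φ' e (cdf (κ1 e) y))
    (mΨ : ∀ y, Measurable fun e => Ψ e (cdf (κ0 e) y))
    (mΨ' : ∀ y, Measurable fun e => Ψ' e (cdf (κ0 e) y))
    {m : Bool → E → ℝ} (hm : ∀ x, Measurable (m x)) (hm01 : ∀ x e, m x e ∈ Icc (0 : ℝ) 1) :
    ∃ (G : Kernel (E × Bool) (ℝ × ℝ)) (K K' : Kernel E (ℝ × ℝ)), IsMarkovKernel G ∧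
      (∀ x e s, (G (e, x)).real s = m x e * (K e).real s + (1 - m x e) * (K' e).real s) ∧
      (∀ x e y, (G (e, x)).real {z | z.1 ≤ y} =
        m x e * Φ e (cdf (κ1 e) y) + (1 - m x e) * Φ' e (cdf (κ1 e) y)) ∧
      (∀ x e y, (G (e, x)).real {z | z.2 ≤ y} =
        m x e * Ψ e (cdf (κ0 e) y) + (1 - m x e) * Ψ' e (cdf (κ0 e) y)) ∧
      (∀ x e y1 y0, (G (e, x)).real {z | z.1 ≤ y1 ∧ z.2 ≤ y0} =
        m x e * (Φ e (cdf (κ1 e) y1) * Ψ e (cdf (κ0 e) y0)) +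
          (1 - m x e) * (Φ' e (cdf (κ1 e) y1) * Ψ' e (cdf (κ0 e) y0))) := by
  obtain ⟨K1, _, hK1⟩ := exists_kernel_of_distortion κ1 hΦ mΦ
  obtain ⟨K1', _, hK1'⟩ := exists_kernel_of_distortion κ1 hΦ' mΦ'
  obtain ⟨K0, _, hK0⟩ := exists_kernel_of_distortion κ0 hΨ mΨ
  obtain ⟨K0', _, hK0'⟩ := exists_kernel_of_distortion κ0 hΨ' mΨ'
  have hmm : Measurable fun e : E × Bool => m e.2 e.1 :=
    measurable_from_prod_countable_left fun x => hm x
  obtain ⟨G, hGM, hG⟩ := exists_kernel_mix ((K1 ×ₖ K0).comap Prod.fst measurable_fst)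
    ((K1' ×ₖ K0').comap Prod.fst measurable_fst) hmm fun e => hm01 e.2 e.1
  have hfst (y : ℝ) : {z : ℝ × ℝ | z.1 ≤ y} = Iic y ×ˢ univ := by ext; simp
  have hsnd (y : ℝ) : {z : ℝ × ℝ | z.2 ≤ y} = univ ×ˢ Iic y := by ext; simp
  have hboth (y y' : ℝ) : {z : ℝ × ℝ | z.1 ≤ y ∧ z.2 ≤ y'} = Iic y ×ˢ Iic y' := rfl
  have hG' : ∀ x e s, (G (e, x)).real s =
      m x e * ((K1 ×ₖ K0) e).real s + (1 - m x e) * ((K1' ×ₖ K0') e).real s :=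
    fun x e s => hG (e, x) s
  refine ⟨G, K1 ×ₖ K0, K1' ×ₖ K0', hGM, hG', fun x e y => ?_, fun x e y => ?_,
    fun x e y1 y0 => ?_⟩
  · rw [hG', hfst, Kernel.prod_apply, Kernel.prod_apply, measureReal_prod_prod,
      measureReal_prod_prod, ← cdf_eq_real, ← cdf_eq_real, hK1, hK1']
    simp
  · rw [hG', hsnd, Kernel.prod_apply, Kernel.prod_apply, measureReal_prod_prod,
      measureReal_prod_prod, ← cdf_eq_real, ← cdf_eq_real, hK0, hK0']
    simp
  · rw [hG', hboth, Kernel.prod_apply, Kernel.prod_apply, measureReal_prod_prod,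
      measureReal_prod_prod, ← cdf_eq_real, ← cdf_eq_real, ← cdf_eq_real, ← cdf_eq_real,
      hK1, hK1', hK0, hK0']

/-- The averaging condition on the propensity for a two-type mixture. -/
theorem mul_mix_mem_Icc {a b p x y : ℝ} (ha : 0 < a) (hap : a < p) (hpb : p < b) (hb : b < 1)
    (hx : 0 ≤ x) (hy : 0 ≤ y) :
    p * (highWeight a b p * x + (1 - highWeight a b p) * y) ∈
      Icc (a * (p * (highWeight a b p * x + (1 - highWeight a b p) * y) +
          (1 - p) * ((1 - highWeight (1 - b) (1 - a) (1 - p)) * x +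
            (1 - (1 - highWeight (1 - b) (1 - a) (1 - p))) * y)))
        (b * (p * (highWeight a b p * x + (1 - highWeight a b p) * y) +
          (1 - p) * ((1 - highWeight (1 - b) (1 - a) (1 - p)) * x +
            (1 - (1 - highWeight (1 - b) (1 - a) (1 - p))) * y))) := by
  have hba := hap.trans hpb
  have e1 : p * (highWeight a b p * x + (1 - highWeight a b p) * y) =
      (p - a) / (b - a) * b * x + (b - p) / (b - a) * a * y := by
    rw [← mul_highWeight (ha.trans hap), ← mul_one_sub_highWeight (ha.trans hap) hba]
    ring
  have e0 : (1 - p) * ((1 - highWeight (1 - b) (1 - a) (1 - p)) * x +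
      (1 - (1 - highWeight (1 - b) (1 - a) (1 - p))) * y) =
      (p - a) / (b - a) * (1 - b) * x + (b - p) / (b - a) * (1 - a) * y := by
    rw [← mul_highWeight_compl (hpb.trans hb), ← mul_one_sub_highWeight_compl (hpb.trans hb) hba]
    ring
  -- These terms are exactly the slacks: the high type exceeds the lower bound by `b - a` times its
  -- mass, and the low type falls short of the upper bound likewise.
  have hx' : 0 ≤ (p - a) / (b - a) * (b - a) * x :=
    mul_nonneg (mul_nonneg (div_nonneg (by linarith) (by linarith)) (by linarith)) hx
  have hy' : 0 ≤ (b - p) / (b - a) * (b - a) * y :=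
    mul_nonneg (mul_nonneg (div_nonneg (by linarith) (by linarith)) (by linarith)) hy
  rw [e1, e0]
  constructor <;> linarith

section

variable {d : ℕ}

theorem lower_upper_mix1 (κX : Kernel (Covariate d) Bool) (κY : Kernel (Covariate d × Bool) ℝ)
    (cl cu : Covariate d → ℝ) (w : Covariate d) (y ε : ℝ) :
    ε * lowerCdf1 κX κY cl cu w y + (1 - ε) * upperCdf1 κX κY cl cu w y =
      boundMix (cl w) (cu w) (propensity κX true w) ε (outcomeCdf κY true w y) := rfl

theorem lower_upper_mix0 (κX : Kernel (Covariate d) Bool) [IsMarkovKernel κX]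
    (κY : Kernel (Covariate d × Bool) ℝ)
    (cl cu : Covariate d → ℝ) (w : Covariate d) (y γ : ℝ) :
    γ * lowerCdf0 κX κY cl cu w y + (1 - γ) * upperCdf0 κX κY cl cu w y =
      boundMix (1 - cu w) (1 - cl w) (1 - propensity κX true w) γ (outcomeCdf κY false w y) := by
  simp only [lowerCdf0, upperCdf0, boundMix, propensity_false, sub_sub_sub_cancel_left]

open Classical in
/-- The distortions and weights of the two-type construction, made trivial wherever the propensity
is not strictly between its bounds. -/
theorem exists_latent_kernel {S : Set (Covariate d)} (hS : MeasurableSet S)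
    (κX : Kernel (Covariate d) Bool) [IsMarkovKernel κX]
    (κY : Kernel (Covariate d × Bool) ℝ) [IsMarkovKernel κY]
    {cl cu : Covariate d → ℝ} (hcl : Measurable cl) (hcu : Measurable cu)
    (hc : ∀ w ∈ S, 0 < cl w ∧ cl w ≤ propensity κX true w ∧ propensity κX true w ≤ cu w ∧ cu w < 1)
    {ε γ : ℝ} (hε : ε ∈ Icc (0 : ℝ) 1) (hγ : γ ∈ Icc (0 : ℝ) 1) :
    ∃ (G : Kernel (Covariate d × Bool) (ℝ × ℝ)) (C : Bool → S → ℝ → ℝ → ℝ),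
      IsMarkovKernel G ∧ C ∈ copulaFamilies S ∧
      (∀ (x : Bool) (w : S) (y1 y0 : ℝ), (G (w, x)).real {z | z.1 ≤ y1 ∧ z.2 ≤ y0} =
        C x w ((G (w, x)).real {z | z.1 ≤ y1}) ((G (w, x)).real {z | z.2 ≤ y0})) ∧
      (∀ (w : S) (y : ℝ), (G (w, true)).real {z | z.1 ≤ y} = outcomeCdf κY true w y) ∧
      (∀ (w : S) (y : ℝ), (G (w, false)).real {z | z.2 ≤ y} = outcomeCdf κY false w y) ∧
      (∀ (w : S) (y : ℝ), propensity κX true w * outcomeCdf κY true w y +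
          propensity κX false w * (G (w, false)).real {z | z.1 ≤ y} =
        boundMix (cl w) (cu w) (propensity κX true w) ε (outcomeCdf κY true w y)) ∧
      (∀ (w : S) (y : ℝ), propensity κX false w * outcomeCdf κY false w y +
          propensity κX true w * (G (w, true)).real {z | z.2 ≤ y} =
        boundMix (1 - cu w) (1 - cl w) (1 - propensity κX true w) γ (outcomeCdf κY false w y)) ∧
      (∀ w ∈ S, ∀ᵐ z ∂(latentLaw κX G w), latentPropensity κX G w z ∈ Icc (cl w) (cu w)) := by
  set p : Covariate d → ℝ := propensity κX true with hp
  have mp : Measurable p := measurable_propensity κX true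
  -- `N` is where both types have positive probability and the denominators `p - a`, `b - p` do not
  -- vanish.
  let N : Set (Covariate d) := S ∩ ({w | cl w < p w} ∩ {w | p w < cu w})
  have hN : MeasurableSet N :=
    hS.inter ((measurableSet_lt hcl mp).inter (measurableSet_lt mp hcu))
  have swap {w} (hw : w ∈ N) : 0 < 1 - cu w ∧ 1 - cu w < 1 - p w ∧ 1 - p w < 1 - cl w :=
    ⟨by linarith [(hc w hw.1).2.2.2], by linarith [show p w < cu w from hw.2.2],
      by linarith [show cl w < p w from hw.2.1]⟩
  let Φ : Covariate d → ℝ → ℝ := fun w u =>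
    if w ∈ N then highDistortion (cl w) (cu w) (p w) ε u else u
  let Φ' : Covariate d → ℝ → ℝ := fun w u =>
    if w ∈ N then lowDistortion (cl w) (cu w) (p w) ε u else u
  -- `Φ` and `Ψ` belong to the same latent type, the one with propensity `cu w`; it is the low type
  -- for the event `X = 0`.
  let Ψ : Covariate d → ℝ → ℝ := fun w u =>
    if w ∈ N then lowDistortion (1 - cu w) (1 - cl w) (1 - p w) γ u else u
  let Ψ' : Covariate d → ℝ → ℝ := fun w u =>
    if w ∈ N then highDistortion (1 - cu w) (1 - cl w) (1 - p w) γ u else u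
  -- Off `N` the weight is `0` and the distortions are identities, leaving the product of the
  -- observed laws for both values of `x`.
  let m : Bool → Covariate d → ℝ := fun x w =>
    if w ∈ N then (if x then highWeight (cl w) (cu w) (p w)
      else 1 - highWeight (1 - cu w) (1 - cl w) (1 - p w)) else 0
  have hΦ w : IsDistortion (Φ w) := by
    by_cases hw : w ∈ N
    · simpa [Φ, hw] using isDistortion_highDistortion (hc w hw.1).1 hw.2.1 hw.2.2 hε
    · simpa [Φ, hw] using IsDistortion.id
  have hΦ' w : IsDistortion (Φ' w) := by
    by_cases hw : w ∈ N
    · simpa [Φ', hw] using isDistortion_lowDistortion (hc w hw.1).1 hw.2.1 hw.2.2 hε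
    · simpa [Φ', hw] using IsDistortion.id
  have hΨ w : IsDistortion (Ψ w) := by
    by_cases hw : w ∈ N
    · simpa [Ψ, hw] using
        isDistortion_lowDistortion (swap hw).1 (swap hw).2.1 (swap hw).2.2 hγ
    · simpa [Ψ, hw] using IsDistortion.id
  have hΨ' w : IsDistortion (Ψ' w) := by
    by_cases hw : w ∈ N
    · simpa [Ψ', hw] using
        isDistortion_highDistortion (swap hw).1 (swap hw).2.1 (swap hw).2.2 hγ
    · simpa [Ψ', hw] using IsDistortion.id
  have hm01 x w : m x w ∈ Icc (0 : ℝ) 1 := by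
    by_cases hw : w ∈ N
    · cases x
      · have := highWeight_mem (swap hw).1 (swap hw).2.1 (swap hw).2.2
        simp only [m, hw, if_true, Bool.false_eq_true, if_false]
        exact ⟨sub_nonneg.2 this.2, by linarith [this.1]⟩
      · simpa [m, hw] using highWeight_mem (hc w hw.1).1 hw.2.1 hw.2.2
    · simp [m, hw]
  have hm x : Measurable (m x) := by
    refine Measurable.ite hN ?_ measurable_const
    cases x
    · simp only [Bool.false_eq_true, if_false]
      fun_prop
    · simp only [if_true]
      fun_prop
  let κ1 : Kernel (Covariate d) ℝ := κY.comap (fun w => (w, true)) measurable_prodMk_right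
  let κ0 : Kernel (Covariate d) ℝ := κY.comap (fun w => (w, false)) measurable_prodMk_right
  have mF1 y : Measurable fun w => cdf (κ1 w) y := measurable_outcomeCdf κY true y
  have mF0 y : Measurable fun w => cdf (κ0 w) y := measurable_outcomeCdf κY false y
  obtain ⟨G, K, K', hGM, hG, hG1, hG0, hG10⟩ := exists_kernel_mix_prod κ1 κ0 hΦ hΦ' hΨ hΨ'
    (fun y => Measurable.ite hN (by have := mF1 y; fun_prop) (mF1 y))
    (fun y => Measurable.ite hN (by have := mF1 y; fun_prop) (mF1 y))
    (fun y => Measurable.ite hN (by have := mF0 y; fun_prop) (mF0 y))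
    (fun y => Measurable.ite hN (by have := mF0 y; fun_prop) (mF0 y)) hm hm01
  -- The copula is built from distortions and weights alone, so atoms in the outcome laws cause no
  -- difficulty.
  choose C hC hCeq using fun (x : Bool) (w : S) =>
    exists_copula_of_mix (hΦ w) (hΦ' w) (hΨ w) (hΨ' w) (hm01 x w)
  have hnot {w} (hwS : w ∈ S) (hw : w ∉ N) : p w = cl w ∨ p w = cu w := by
    by_contra! h
    exact hw ⟨hwS, (hc w hwS).2.1.lt_of_ne h.1.symm, (hc w hwS).2.2.1.lt_of_ne h.2⟩
  refine ⟨G, C, hGM, hC, fun x w y1 y0 => ?_, fun w y => ?_, fun w y => ?_, fun w y => ?_,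
    fun w y => ?_, fun w hwS => ae_latentPropensity_mem_Icc κX G w fun s => ?_⟩
  · rw [hG10, hG1, hG0, hCeq x w _ ⟨cdf_nonneg _ _, cdf_le_one _ _⟩ _
      ⟨cdf_nonneg _ _, cdf_le_one _ _⟩]
  · rw [hG1]
    by_cases hw : (w : Covariate d) ∈ N
    · simp only [m, Φ, Φ', hw, if_true]
      exact highWeight_mix (hc w hw.1).1 hw.2.1 hw.2.2 _
    · simp only [m, Φ, Φ', hw, if_false, zero_mul, zero_add, sub_zero, one_mul]
      rfl
  · rw [hG0]
    by_cases hw : (w : Covariate d) ∈ N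
    · simp only [m, Ψ, Ψ', hw, if_true, Bool.false_eq_true, if_false, sub_sub_cancel]
      rw [add_comm]
      exact highWeight_mix (swap hw).1 (swap hw).2.1 (swap hw).2.2 _
    · simp only [m, Ψ, Ψ', hw, if_false, zero_mul, zero_add, sub_zero, one_mul]
      rfl
  · rw [hG1, propensity_false, ← hp]
    obtain ⟨h0, h1, h2, h3⟩ := hc w w.2
    by_cases hw : (w : Covariate d) ∈ N
    · simp only [m, Φ, Φ', hw, if_true, Bool.false_eq_true, if_false, sub_sub_cancel]
      exact average_eq_boundMix hw.2.1 hw.2.2 (by linarith) (by linarith) _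
    · simp only [m, Φ, Φ', hw, if_false, zero_mul, zero_add, sub_zero, one_mul]
      rw [boundMix_of_eq h0 h1 h2 (hnot w.2 hw) (outcomeCdf_mem _ _ _ _)]
      change p w * outcomeCdf κY true w y + (1 - p w) * outcomeCdf κY true w y = _
      ring
  · rw [hG0, propensity_false, ← hp]
    obtain ⟨h0, h1, h2, h3⟩ := hc w w.2
    by_cases hw : (w : Covariate d) ∈ N
    · have := average_eq_boundMix (ε := γ) (swap hw).2.1 (swap hw).2.2 (by linarith) (by linarith)
        (outcomeCdf κY false w y)
      simp only [sub_sub_cancel] at this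
      simp only [m, Ψ, Ψ', hw, if_true]
      rw [← this, add_comm (highWeight _ _ _ * _)]
      rfl
    · simp only [m, Ψ, Ψ', hw, if_false, zero_mul, zero_add, sub_zero, one_mul]
      rw [boundMix_of_eq (by linarith) (by linarith) (by linarith)
        ((hnot w.2 hw).symm.imp (congrArg _) (congrArg _)) (outcomeCdf_mem _ _ _ _)]
      change (1 - p w) * outcomeCdf κY false w y + p w * outcomeCdf κY false w y = _
      ring
  · rw [propensity_false, ← hp, hG, hG]
    obtain ⟨h0, h1, h2, h3⟩ := hc w hwS
    by_cases hw : (w : Covariate d) ∈ N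
    · simp only [m, hw, if_true, Bool.false_eq_true, if_false]
      exact mul_mix_mem_Icc h0 hw.2.1 hw.2.2 h3 measureReal_nonneg measureReal_nonneg
    -- Here the outcomes are independent of `X`, so the latent propensity condition reduces to `cl w
    -- ≤ p w ≤ cu w`.
    · simp only [m, hw, if_false, zero_mul, zero_add, sub_zero, one_mul]
      have hK : 0 ≤ (K' w).real s := measureReal_nonneg
      have e : p w * (K' w).real s + (1 - p w) * (K' w).real s = (K' w).real s := by ring
      rw [e]
      exact ⟨mul_le_mul_of_nonneg_right h1 hK, mul_le_mul_of_nonneg_right h2 hK⟩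

end

theorem mainTheorem2 {d : ℕ} {Ω : Type*} [MeasurableSpace Ω]
    (P : Measure Ω) [IsProbabilityMeasure P]
    (Y1 Y0 : Ω → ℝ) (X : Ω → Bool) (W : Ω → Covariate d)
    (hY1 : Measurable Y1) (hY0 : Measurable Y0) (hX : Measurable X) (hW : Measurable W)
    (κX : Kernel (Covariate d) Bool) [IsMarkovKernel κX]
    (hκX : HasCondDistrib X W κX P)
    (κY : Kernel (Covariate d × Bool) ℝ) [IsMarkovKernel κY]
    (hκY : HasCondDistrib (realizedOutcome X Y1 Y0) (fun ω => (W ω, X ω)) κY P)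
    (G : Kernel (Covariate d × Bool) (ℝ × ℝ)) [IsMarkovKernel G]
    (hG : HasCondDistrib (fun ω => (Y1 ω, Y0 ω)) (fun ω => (W ω, X ω)) G P)
    (cl cu : Covariate d → ℝ) (hcl : Measurable cl) (hcu : Measurable cu)
    (hoverlap : Overlap (P.map W).support κX)
    (hjoint : JointCDependence (P.map W).support κX G cl cu) :
    ∀ ε ∈ Icc (0 : ℝ) 1, ∀ γ ∈ Icc (0 : ℝ) 1,
      ∃ C ∈ copulaFamilies (P.map W).support,
        ((fun w y => ε * lowerCdf1 κX κY cl cu w y + (1 - ε) * upperCdf1 κX κY cl cu w y,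
          fun w y => γ * lowerCdf0 κX κY cl cu w y + (1 - γ) * upperCdf0 κX κY cl cu w y,
          C) : ((P.map W).support → ℝ → ℝ) × ((P.map W).support → ℝ → ℝ) ×
            (Bool → (P.map W).support → ℝ → ℝ → ℝ)) ∈
          identifiedSetJoint0 (P.map W).support κX κY cl cu := by
  intro ε hε γ hγ
  obtain ⟨G', C, hG', hC, hjcdf, h1, h0, ha1, ha0, hdep⟩ :=
    exists_latent_kernel Measure.isClosed_support.measurableSet κX κY hcl hcu
      (fun w hw => (hjoint w hw).1) hε hγ
  refine ⟨C, hC, (fun x w y => (G' (w, x)).real {z | z.1 ≤ y},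
    fun x w y => (G' (w, x)).real {z | z.2 ≤ y}, C),
    ⟨hC, G', hG', fun _ _ _ => rfl, fun _ _ _ => rfl, hjcdf, h1, h0,
      fun w hw => ⟨(hjoint w hw).1, hdep w hw⟩⟩, ?_⟩
  refine Prod.ext ?_ (Prod.ext ?_ rfl)
  · funext w y
    simp only [averageOverTreatment, lower_upper_mix1, ← ha1, h1]
    ring
  · funext w y
    simp only [averageOverTreatment, lower_upper_mix0, ← ha0, h0]
    ring
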